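/- Let $l$ be a prime and $m\ge 1$ such that $2$ is a primitive root modulo $l^m$, and let $q=2^{\phi(l^m)}$, where $\phi$ is Euler's totient function. Let $\gamma$ be a primitive element of $\mathbb F_q$, put $\alpha=\gamma^{(q-1)/l^m}$, let $\mathrm{Tr}$ be the trace from $\mathbb F_q$ to $\mathbb F_2$, let $a\in\mathbb F_q^*$, and put $S(a)=\sum_{i=0}^{l^m-1}(-1)^{\mathrm{Tr}(a\alpha^i)}$. Let $$D=D_{(a,0)}=\{(x,y)\in\mathbb F_q^2\setminus\{(0,0)\}:\ \mathrm{Tr}(ax^{(q-1)/l^m})=0\},$$ and let $C=C_{D_{(a,0)}}$ be the binary linear code $$C=\{(\mathrm{Tr}(ux+vy))_{(x,y)\in D}:\ (u,v)\in\mathbb F_q^2\}\subseteq\mathbb F_2^{D}.$$ For $1\le r\le\dim C$ let $d_r(C)$ be its $r$-th generalized Hamming weight, i.e. the minimum, over all $r$-dimensional subspaces $V$ of $C$, of the number of coordinates at which some word of $V$ is nonzero. Assume that $l^m\ne 3$ and that it is not the case that both $l^m=5$ and $S(a)=-3$. Then $\dim C=2\phi(l^m)$, and $$d_r(C)=\begin{cases}\frac12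 q\left(1-\frac1{2^r}\right)\left(q-\sqrt q+\frac{(q+\sqrt q)S(a)}{l^m}\right), & 1\le r\le\frac12\phi(l^m),\\[4pt] \frac12 q\left(q+1+\frac{(q-1)S(a)}{l^m}\right)-\frac{1}{2^r}q^2, & \frac12\phi(l^m)<r\le 2\phi(l^m).\end{cases}$$ -/

import Mathlib

noncomputable section

namespace LinearCode

/-- The support of a code `V` of words indexed by `ι`: all coordinates at which
some word of `V` is nonzero. -/
def support {K ι : Type*} [Field K] (V : Submodule K (ι → K)) : Set ι :=
  {i | ∃ c ∈ V, c i ≠ 0}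

/-- The `r`-th generalized Hamming weight of a linear code `C`: the least support size of an
`r`-dimensional subcode of `C` (meaningful for `1 ≤ r ≤ dim C`). -/
def generalizedHammingWeight {K ι : Type*} [Field K] (C : Submodule K (ι → K)) (r : ℕ) : ℕ :=
  sInf {n : ℕ | ∃ V : Submodule K (ι → K),
    V ≤ C ∧ Module.finrank K V = r ∧ (support V).ncard = n}

section

variable {F : Type*} [Field F] [Algebra (ZMod 2) F]

/-- The map `(u, v) ↦ (Tr (u x + v y))_{(x, y) ∈ D}`. -/
def traceMap (D : Set (F × F)) : (F × F) →ₗ[ZMod 2] (D → ZMod 2) where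
  toFun u := fun d => Algebra.trace (ZMod 2) F (u.1 * d.1.1 + u.2 * d.1.2)
  map_add' u v := by
    funext d
    simp only [Prod.fst_add, Prod.snd_add, Pi.add_apply, ← map_add]
    congr 1
    ring
  map_smul' c u := by
    funext d
    simp only [Prod.smul_fst, Prod.smul_snd, smul_mul_assoc, ← smul_add, map_smul,
      RingHom.id_apply, Pi.smul_apply]

/-- The binary linear code with defining set `D`, its coordinates being indexed by `D`. -/
def codeOfDefiningSet (D : Set (F × F)) : Submodule (ZMod 2) (D → ZMod 2) :=
  LinearMap.range (traceMap D)

/-- The canonical additive character `x ↦ (-1) ^ Tr x` of a finite field of characteristic two. -/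
def canonicalChar (x : F) : ℤ := (-1) ^ (Algebra.trace (ZMod 2) F x).val

/-- The set of all `(x, y) ≠ (0, 0)` with `Tr (a x ^ ((q - 1) / N) + b y) = 0`, where `q = |F|`. -/
def definingSet [Fintype F] (N : ℕ) (a b : F) : Set (F × F) :=
  {z | z ≠ 0 ∧
    Algebra.trace (ZMod 2) F (a * z.1 ^ ((Fintype.card F - 1) / N) + b * z.2) = 0}

/-- The sum `∑_{i < N} χ (a α ^ i)` with `α = γ ^ ((q - 1) / N)`, where `q = |F|`. -/
def charSum [Fintype F] (N : ℕ) (γ a : F) : ℤ :=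
  ∑ i ∈ Finset.range N, canonicalChar (a * (γ ^ ((Fintype.card F - 1) / N)) ^ i)

end

end LinearCode

end

/-!
Put `N = l ^ m`, `φ(N) = 2 k` and `Q = 2 ^ k`, so that `q = Q ^ 2`. Let `K` be the subfield of `F`
with `Q` elements and `A` the set of all `x` with `Tr (a x ^ ((q - 1) / N)) = 1`; the defining set
is then `(F \ A) × F` without the origin. As `2` is a primitive root modulo `N`, one has
`N ∣ Q + 1` (`dvd_two_pow_half_totient_add_one`), so `Q - 1` divides `(q - 1) / N`, and `A` is
stable under multiplication by nonzero elements of `K`.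

By duality for the trace pairing on `F × F` (`generalizedHammingWeight_eq`), `d_r` is the least
number of points of the defining set outside a subspace `W` of codimension `r`. By inclusion and
exclusion (`ncard_notMem`) that number is `q ^ 2 - q ^ 2 / 2 ^ r - |A| q + X`, where `X` is the
number of points of `W` in `A × F`, so that only `X` has to be minimized.

* Each line `K z` meets `W` in at least `Q / 2 ^ r` points. Adding this up over `z ∈ A × F`, a union
  of such lines without the origin, gives `(Q - 1) X ≥ |A| q (Q / 2 ^ r - 1)`
  (`le_card_filter_mem`).
* Let `w ≠ 0` lie outside `A`. The form `(x, y) ↦ Tr_{F/K} (w⁻¹ x)` has kernel `K w × F`, which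
  misses `A × F`. For `r ≤ k`, the preimage of a subspace of `K` of codimension `r` attains the
  bound (`exists_card_filter_mem_eq`). For `r ≥ k`, the kernel contains a `W` of codimension `r`, for
  which `X = 0` (`exists_forall_notMem`).

The cardinality of `A` is expressed by the character sum in `two_mul_card_trace_ne_zero`. The
duality needs the dimension to be `4 k`, i.e. the defining set must not lie in a hyperplane. By the
bound for `r = 1` this follows from `|A| < Q (Q - 1)`, i.e. from `N < n (Q + 1)`, where `n` is the
number of `i < N` with `Tr (a α ^ i) = 0`. Vanishing of the sum of the `l`-th roots of unity gives
enough such `i`, except in the excluded cases (`lt_traceZeros_mul`).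
-/

noncomputable section

namespace LinearCode

open Module

/-! ### Subspaces, preimages and dimensions -/

section LinearAlgebra

variable {K V V' : Type*} [Field K] [AddCommGroup V] [Module K V] [AddCommGroup V'] [Module K V']

lemma exists_submodule_le_finrank_eq [FiniteDimensional K V] (W : Submodule K V) {s : ℕ}
    (hs : s ≤ finrank K W) : ∃ U ≤ W, finrank K U = s := by
  have hli : LinearIndependent K
      (fun i : Fin s => ((finBasis K W (Fin.castLE hs i) : W) : V)) := by
    have h := (finBasis K W).linearIndependent.comp _ (Fin.castLE_injective hs)
    exact h.map' W.subtype W.ker_subtype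
  refine ⟨Submodule.span K (Set.range _), ?_, (finrank_span_eq_card hli).trans (Fintype.card_fin s)⟩
  rw [Submodule.span_le]
  rintro _ ⟨i, rfl⟩
  exact Subtype.prop _

lemma finrank_comap_of_le_range [FiniteDimensional K V] (f : V →ₗ[K] V') {P : Submodule K V'}
    (hP : P ≤ LinearMap.range f) :
    finrank K (P.comap f) = finrank K P + finrank K (LinearMap.ker f) := by
  have h := LinearMap.finrank_range_add_finrank_ker (f.domRestrict (P.comap f))
  rw [LinearMap.range_domRestrict, Submodule.map_comap_eq, inf_eq_right.mpr hP,
    LinearMap.ker_domRestrict] at h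
  rw [← h]
  congr 1
  have hle : LinearMap.ker f ≤ P.comap f := fun x hx => by
    rw [Submodule.mem_comap, LinearMap.mem_ker.mp hx]; exact P.zero_mem
  exact (Submodule.comapSubtypeEquivOfLe hle).finrank_eq

/-- Intersecting a subspace with a preimage of `W` lowers the dimension by at most the
codimension of `W`. -/
lemma finrank_add_le_finrank_inf_comap [FiniteDimensional K V] [FiniteDimensional K V']
    (f : V →ₗ[K] V') (U : Submodule K V) (W : Submodule K V') :
    finrank K U + finrank K W ≤ finrank K (U ⊓ W.comap f : Submodule K V) + finrank K V' := by
  have h := LinearMap.finrank_range_add_finrank_ker ((W.mkQ ∘ₗ f).domRestrict U)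
  have hr := Submodule.finrank_le (LinearMap.range ((W.mkQ ∘ₗ f).domRestrict U))
  have hW := Submodule.finrank_quotient_add_finrank W
  have hk : finrank K (LinearMap.ker ((W.mkQ ∘ₗ f).domRestrict U)) =
      finrank K (U ⊓ W.comap f : Submodule K V) := by
    rw [LinearMap.ker_domRestrict, LinearMap.ker_comp, Submodule.ker_mkQ,
      show (W.comap f).comap U.subtype = (U ⊓ W.comap f).comap U.subtype by ext; simp]
    exact (Submodule.comapSubtypeEquivOfLe inf_le_left).finrank_eq
  omega

end LinearAlgebra

/-! ### Generalized Hamming weights by trace duality -/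

section Weights

variable {F : Type*} [Field F] [Algebra (ZMod 2) F]

variable (F) in
/-- The nondegenerate pairing `(u, v), (x, y) ↦ Tr (u x + v y)` on `F × F`. -/
def tracePairing : LinearMap.BilinForm (ZMod 2) (F × F) :=
  LinearMap.mk₂ (ZMod 2) (fun u d => Algebra.trace (ZMod 2) F (u.1 * d.1 + u.2 * d.2))
    (fun u v d => by simp only [Prod.fst_add, Prod.snd_add, ← map_add]; congr 1; ring)
    (fun c u d => by simp only [Prod.smul_fst, Prod.smul_snd, smul_mul_assoc, ← smul_add, map_smul])
    (fun u d e => by simp only [Prod.fst_add, Prod.snd_add, ← map_add]; congr 1; ring)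
    (fun c u d => by simp only [Prod.smul_fst, Prod.smul_snd, mul_smul_comm, ← smul_add, map_smul])

lemma tracePairing_apply (u d : F × F) :
    tracePairing F u d = Algebra.trace (ZMod 2) F (u.1 * d.1 + u.2 * d.2) := rfl

lemma tracePairing_isRefl : (tracePairing F).IsRefl := fun u d h => by
  rw [tracePairing_apply] at h ⊢
  rwa [mul_comm d.1, mul_comm d.2]

/-- The coordinates in the support of the subcode attached to `U` are the points of `D` outside the
orthogonal complement of `U`. -/
lemma support_map_traceMap_ncard (D : Set (F × F)) (U : Submodule (ZMod 2) (F × F)) :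
    (support (U.map (traceMap D))).ncard =
      {d | d ∈ D ∧ d ∉ (tracePairing F).orthogonal U}.ncard := by
  rw [← Set.ncard_image_of_injective _ (Subtype.val_injective (p := (· ∈ D)))]
  congr 1
  ext d
  simp only [Set.mem_image, support, Set.mem_ofPred_eq, Submodule.mem_map,
    LinearMap.BilinForm.mem_orthogonal_iff]
  constructor
  · rintro ⟨d, ⟨_, ⟨u, hu, rfl⟩, hd⟩, rfl⟩
    exact ⟨d.2, fun h => hd (h u hu)⟩
  · rintro ⟨hd, h⟩
    push Not at h
    obtain ⟨u, hu, h⟩ := h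
    exact ⟨⟨d, hd⟩, ⟨_, ⟨u, hu, rfl⟩, h⟩, rfl⟩

variable [Fintype F]

lemma tracePairing_eq_zero {u : F × F} (h : ∀ d, tracePairing F u d = 0) : u = 0 := by
  have key : ∀ x : F, (∀ y, Algebra.trace (ZMod 2) F (x * y) = 0) → x = 0 := fun x hx =>
    (traceForm_nondegenerate (ZMod 2) F).1 x hx
  refine Prod.ext (key _ fun y => ?_) (key _ fun y => ?_)
  · simpa [tracePairing_apply] using h (y, 0)
  · simpa [tracePairing_apply] using h (0, y)

lemma tracePairing_nondegenerate : (tracePairing F).Nondegenerate :=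
  ⟨fun _ h => tracePairing_eq_zero h,
    fun _ h => tracePairing_eq_zero fun d => tracePairing_isRefl _ _ (h d)⟩

/-- The trace map is injective unless `D` lies in a hyperplane. -/
lemma traceMap_injective {D : Set (F × F)}
    (hD : ∀ W : Submodule (ZMod 2) (F × F), finrank (ZMod 2) W + 1 = finrank (ZMod 2) (F × F) →
      ¬ D ⊆ W) : Function.Injective (traceMap D) := by
  rw [← LinearMap.ker_eq_bot, LinearMap.ker_eq_bot']
  intro u hu
  by_contra hne
  refine hD (LinearMap.ker (tracePairing F u)) ?_ fun d hd => congrFun hu ⟨d, hd⟩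
  refine Module.Dual.finrank_ker_add_one_of_ne_zero fun h0 => hne ?_
  exact tracePairing_eq_zero fun d => by rw [h0]; rfl

/-- By duality, the generalized Hamming weight is the least number of points of `D` outside a
subspace of codimension `r`. -/
lemma generalizedHammingWeight_eq {D : Set (F × F)} (hinj : Function.Injective (traceMap D))
    (r : ℕ) :
    generalizedHammingWeight (codeOfDefiningSet D) r =
      sInf {n | ∃ W : Submodule (ZMod 2) (F × F),
        finrank (ZMod 2) W + r = finrank (ZMod 2) (F × F) ∧ {d | d ∈ D ∧ d ∉ W}.ncard = n} := by
  rw [generalizedHammingWeight]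
  congr 1
  ext n
  have hB := tracePairing_nondegenerate (F := F)
  have hR := tracePairing_isRefl (F := F)
  have hfin (U : Submodule (ZMod 2) (F × F)) :
      finrank (ZMod 2) (U.map (traceMap D)) = finrank (ZMod 2) U :=
    (LinearEquiv.finrank_eq (Submodule.equivMapOfInjective _ hinj U)).symm
  have horth (U : Submodule (ZMod 2) (F × F)) := LinearMap.BilinForm.finrank_orthogonal hB U
  have hle (U : Submodule (ZMod 2) (F × F)) := Submodule.finrank_le U
  constructor
  · rintro ⟨V, hV, hr, hn⟩
    have hVU : (V.comap (traceMap D)).map (traceMap D) = V :=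
      Submodule.map_comap_eq_of_le hV
    refine ⟨(tracePairing F).orthogonal (V.comap (traceMap D)), ?_, ?_⟩
    · have := hfin (V.comap (traceMap D))
      have := horth (V.comap (traceMap D))
      have := hle (V.comap (traceMap D))
      rw [hVU] at *
      omega
    · rw [← support_map_traceMap_ncard, hVU, hn]
  · rintro ⟨W, hr, hn⟩
    refine ⟨((tracePairing F).orthogonal W).map (traceMap D), ?_, ?_, ?_⟩
    · exact LinearMap.map_le_range
    · rw [hfin, horth]; omega
    · rw [support_map_traceMap_ncard, LinearMap.BilinForm.orthogonal_orthogonal hB hR, hn]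

end Weights

/-! ### The relative trace to the subfield with `2 ^ k` elements -/

section RelativeTrace

variable {F : Type*} [Field F] [Algebra (ZMod 2) F]

variable (F) in
/-- The map `x ↦ x + x ^ 2 ^ k`. On a field with `2 ^ (2 k)` elements it is the relative trace to
the subfield with `2 ^ k` elements, and its kernel is that subfield. -/
def relTrace (k : ℕ) : F →ₗ[ZMod 2] F :=
  haveI : CharP F 2 := charP_of_injective_algebraMap (algebraMap (ZMod 2) F).injective 2
  AddMonoidHom.toZModLinearMap 2 (AddMonoidHom.id F + (iterateFrobenius F 2 k).toAddMonoidHom)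

lemma relTrace_apply (k : ℕ) (x : F) : relTrace F k x = x + x ^ 2 ^ k := rfl

lemma mem_ker_relTrace {k : ℕ} {x : F} : x ∈ LinearMap.ker (relTrace F k) ↔ x ^ 2 ^ k = x := by
  have : CharP F 2 := charP_of_injective_algebraMap (algebraMap (ZMod 2) F).injective 2
  rw [LinearMap.mem_ker, relTrace_apply, CharTwo.add_eq_zero, eq_comm]

lemma relTrace_mul {k : ℕ} {t : F} (ht : t ∈ LinearMap.ker (relTrace F k)) (x : F) :
    relTrace F k (t * x) = t * relTrace F k x := by
  rw [mem_ker_relTrace] at ht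
  rw [relTrace_apply, relTrace_apply, mul_pow, ht, mul_add]

lemma mul_mem_ker_relTrace {k : ℕ} {s t : F} (hs : s ∈ LinearMap.ker (relTrace F k))
    (ht : t ∈ LinearMap.ker (relTrace F k)) : s * t ∈ LinearMap.ker (relTrace F k) := by
  rw [LinearMap.mem_ker, relTrace_mul hs, LinearMap.mem_ker.mp ht, mul_zero]

lemma inv_mem_ker_relTrace {k : ℕ} {s : F} (hs : s ∈ LinearMap.ker (relTrace F k)) :
    s⁻¹ ∈ LinearMap.ker (relTrace F k) := by
  rw [mem_ker_relTrace] at hs ⊢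
  rw [inv_pow, hs]

variable [Fintype F] {k : ℕ}

lemma finrank_eq_of_card (hF : Fintype.card F = 2 ^ (2 * k)) : finrank (ZMod 2) F = 2 * k := by
  have h := Module.natCard_eq_pow_finrank (K := ZMod 2) (V := F)
  rw [Nat.card_eq_fintype_card, hF, Nat.card_zmod] at h
  exact (Nat.pow_right_injective le_rfl h).symm

lemma range_relTrace_le (hF : Fintype.card F = 2 ^ (2 * k)) :
    LinearMap.range (relTrace F k) ≤ LinearMap.ker (relTrace F k) := by
  have : CharP F 2 := charP_of_injective_algebraMap (algebraMap (ZMod 2) F).injective 2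
  rintro _ ⟨x, rfl⟩
  have hx : (x ^ 2 ^ k) ^ 2 ^ k = x := by
    rw [← pow_mul, ← pow_add, ← two_mul, ← hF, FiniteField.pow_card]
  rw [mem_ker_relTrace, relTrace_apply, add_pow_char_pow, hx, add_comm]

lemma finrank_ker_relTrace (hF : Fintype.card F = 2 ^ (2 * k)) :
    finrank (ZMod 2) (LinearMap.ker (relTrace F k)) = k := by
  have hk : k ≠ 0 := by
    rintro rfl
    exact Fintype.one_lt_card.ne' hF
  have hr := LinearMap.finrank_range_add_finrank_ker (relTrace F k)
  rw [finrank_eq_of_card hF] at hr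
  have hle := Submodule.finrank_mono (range_relTrace_le hF)
  suffices finrank (ZMod 2) (LinearMap.ker (relTrace F k)) ≤ k by omega
  -- the kernel consists of roots of `X ^ 2 ^ k - X`
  have h1 : 1 < 2 ^ k := Nat.one_lt_two_pow hk
  have hsub : (LinearMap.ker (relTrace F k) : Set F) ⊆
      (Polynomial.X ^ 2 ^ k - Polynomial.X : Polynomial F).rootSet F := fun x hx => by
    rw [Polynomial.mem_rootSet_of_ne (FiniteField.X_pow_card_sub_X_ne_zero F h1)]
    simp [mem_ker_relTrace.mp hx]
  have hcard := (Set.ncard_le_ncard hsub (Set.toFinite _)).trans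
    (Polynomial.ncard_rootSet_le _ F)
  rw [FiniteField.X_pow_card_sub_X_natDegree_eq F h1, ← Nat.card_coe_set_eq,
    SetLike.coe_sort_coe,
    Module.natCard_eq_pow_finrank (K := ZMod 2), Nat.card_zmod] at hcard
  exact (Nat.pow_le_pow_iff_right one_lt_two).mp hcard

lemma range_relTrace (hF : Fintype.card F = 2 ^ (2 * k)) :
    LinearMap.range (relTrace F k) = LinearMap.ker (relTrace F k) := by
  refine Submodule.eq_of_le_of_finrank_eq (range_relTrace_le hF) ?_
  have hr := LinearMap.finrank_range_add_finrank_ker (relTrace F k)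
  rw [finrank_eq_of_card hF, finrank_ker_relTrace hF] at hr
  rw [finrank_ker_relTrace hF]
  omega

end RelativeTrace

/-! ### Counting points of subspaces on cones over the subfield -/

section Cones

variable {F : Type*} [Field F] [Algebra (ZMod 2) F]

/-- The elements `t` of the subfield with `2 ^ k` elements for which `t z` lies in `W`. -/
def multipliers (k : ℕ) (W : Submodule (ZMod 2) (F × F)) (z : F × F) : Submodule (ZMod 2) F :=
  LinearMap.ker (relTrace F k) ⊓
    W.comap ((LinearMap.toSpanSingleton F (F × F) z).restrictScalars (ZMod 2))

lemma mem_multipliers {k : ℕ} {W : Submodule (ZMod 2) (F × F)} {z : F × F} {t : F} :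
    t ∈ multipliers k W z ↔ t ∈ LinearMap.ker (relTrace F k) ∧ t • z ∈ W := Iff.rfl

variable [Fintype F] {k : ℕ}

lemma le_finrank_multipliers_add (hF : Fintype.card F = 2 ^ (2 * k))
    {W : Submodule (ZMod 2) (F × F)} {r : ℕ}
    (hW : finrank (ZMod 2) W + r = finrank (ZMod 2) (F × F)) (z : F × F) :
    k ≤ finrank (ZMod 2) (multipliers k W z) + r := by
  have h := finrank_add_le_finrank_inf_comap
    ((LinearMap.toSpanSingleton F (F × F) z).restrictScalars (ZMod 2))
    (LinearMap.ker (relTrace F k)) W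
  rw [finrank_ker_relTrace hF] at h
  change _ ≤ finrank (ZMod 2) (multipliers k W z) + _ at h
  omega

open Classical in
/-- Double counting of the pairs `(t, z)` with `t z ∈ W`, where `t ≠ 0` lies in the subfield with
`2 ^ k` elements and the first coordinate of `z` lies in a set stable under such `t`. -/
lemma sum_card_multipliers (hF : Fintype.card F = 2 ^ (2 * k)) (W : Submodule (ZMod 2) (F × F))
    {A : Finset F}
    (hA : ∀ t ∈ LinearMap.ker (relTrace F k), t ≠ 0 → ∀ x, t * x ∈ A ↔ x ∈ A) :
    ∑ z ∈ A ×ˢ (Finset.univ : Finset F), (2 : ℝ) ^ finrank (ZMod 2) (multipliers k W z) =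
      ((2 : ℝ) ^ k - 1) * ((A ×ˢ (Finset.univ : Finset F)).filter (· ∈ W)).card +
        A.card * (Fintype.card F : ℝ) := by
  set U : Finset F := Finset.univ.filter (fun t => t ∈ LinearMap.ker (relTrace F k) ∧ t ≠ 0)
  set B := A ×ˢ (Finset.univ : Finset F)
  have hU : (U.card : ℝ) = 2 ^ k - 1 := by
    have h : insert 0 U = Finset.univ.filter (fun t => t ∈ LinearMap.ker (relTrace F k)) := by
      ext t
      by_cases ht : t = 0 <;> simp [U, ht]
    have h' : U.card + 1 = 2 ^ k := by
      rw [← Finset.card_insert_of_notMem (a := (0 : F)) (by simp [U]), h,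
        ← Fintype.card_subtype, ← Nat.card_eq_fintype_card]
      have := Module.natCard_eq_pow_finrank (K := ZMod 2) (V := LinearMap.ker (relTrace F k))
      rwa [finrank_ker_relTrace hF, Nat.card_zmod] at this
    rw [eq_sub_iff_add_eq]
    exact_mod_cast h'
  have hz (z : F × F) : (2 : ℝ) ^ finrank (ZMod 2) (multipliers k W z) =
      (U.filter (fun t => t • z ∈ W)).card + 1 := by
    have h : insert 0 (U.filter (fun t => t • z ∈ W)) =
        Finset.univ.filter (fun t => t ∈ multipliers k W z) := by
      ext t
      by_cases ht : t = 0 <;> simp [U, ht, mem_multipliers]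
    have h' : (U.filter (fun t => t • z ∈ W)).card + 1 =
        2 ^ finrank (ZMod 2) (multipliers k W z) := by
      rw [← Finset.card_insert_of_notMem (a := (0 : F)) (by simp [U]), h,
        ← Fintype.card_subtype, ← Nat.card_eq_fintype_card]
      have := Module.natCard_eq_pow_finrank (K := ZMod 2) (V := multipliers k W z)
      rwa [Nat.card_zmod] at this
    exact_mod_cast h'.symm
  have hswap := Finset.sum_card_bipartiteAbove_eq_sum_card_bipartiteBelow
    (s := B) (t := U) (fun z t => t • z ∈ W)
  have hbelow : ∀ t ∈ U, (B.bipartiteBelow (fun z t => t • z ∈ W) t).card =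
      (B.filter (· ∈ W)).card := by
    intro t ht
    obtain ⟨-, htK, ht0⟩ := Finset.mem_filter.mp ht
    refine Finset.card_nbij' (fun z => t • z) (fun z => t⁻¹ • z) ?_ ?_ ?_ ?_
    · intro z hz
      simp only [Finset.bipartiteBelow, Finset.coe_filter, Set.mem_ofPred_eq, B,
        Finset.mem_product, Finset.mem_univ, and_true, Prod.smul_fst, smul_eq_mul] at hz ⊢
      exact ⟨(hA t htK ht0 _).mpr hz.1, hz.2⟩
    · intro z hz
      simp only [Finset.bipartiteBelow, Finset.coe_filter, Set.mem_ofPred_eq, B,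
        Finset.mem_product, Finset.mem_univ, and_true, Prod.smul_fst, smul_eq_mul] at hz ⊢
      rw [smul_inv_smul₀ ht0]
      exact ⟨(hA _ (inv_mem_ker_relTrace htK) (inv_ne_zero ht0) _).mpr hz.1, hz.2⟩
    · intro z _; exact inv_smul_smul₀ ht0 z
    · intro z _; exact smul_inv_smul₀ ht0 z
  rw [Finset.sum_congr rfl hbelow, Finset.sum_const, smul_eq_mul] at hswap
  have hswap' : ∑ z ∈ B, ((U.filter (fun t => t • z ∈ W)).card : ℝ) =
      U.card * (B.filter (· ∈ W)).card := by exact_mod_cast hswap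
  simp_rw [hz, Finset.sum_add_distrib, hswap', hU]
  simp [B, Finset.card_product]

end Cones

/-! ### The extremal subspaces -/

section ConePoints

variable {F : Type*} [Field F] [Algebra (ZMod 2) F] {k : ℕ}

variable (k) in
/-- The map `(x, y) ↦ Tr (w⁻¹ x)`, with the relative trace to the subfield with `2 ^ k` elements, whose
kernel is the product of the line spanned by `w` over that subfield with `F`. -/
def lineForm (w : F) : F × F →ₗ[ZMod 2] F :=
  relTrace F k ∘ₗ LinearMap.mulLeft (ZMod 2) w⁻¹ ∘ₗ LinearMap.fst (ZMod 2) F F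

lemma lineForm_apply (w : F) (z : F × F) : lineForm k w z = relTrace F k (w⁻¹ * z.1) := rfl

lemma lineForm_ne_zero {w : F} (hw : w ≠ 0) {A : Finset F}
    (hA : ∀ t ∈ LinearMap.ker (relTrace F k), t ≠ 0 → ∀ x, t * x ∈ A ↔ x ∈ A)
    (h0 : (0 : F) ∉ A) (hwA : w ∉ A) {z : F × F} (hz : z.1 ∈ A) : lineForm k w z ≠ 0 := by
  intro h
  have hz0 : z.1 ≠ 0 := fun h' => h0 (h' ▸ hz)
  refine hwA ((hA _ (LinearMap.mem_ker.mpr h) (mul_ne_zero (inv_ne_zero hw) hz0) w).mp ?_)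
  change w⁻¹ * z.1 * w ∈ A
  rwa [mul_right_comm, inv_mul_cancel₀ hw, one_mul]

variable [Fintype F]

lemma finrank_prod_eq (hF : Fintype.card F = 2 ^ (2 * k)) :
    finrank (ZMod 2) (F × F) = 4 * k := by
  rw [Module.finrank_prod, finrank_eq_of_card hF]
  ring

open Classical in
/-- A subspace of codimension `r` contains at least the expected number of points over `A`: it meets
every line over the subfield with `2 ^ k` elements in at least `2 ^ (k - r)` points. -/
lemma le_card_filter_mem (hF : Fintype.card F = 2 ^ (2 * k)) {W : Submodule (ZMod 2) (F × F)}
    {r : ℕ} (hW : finrank (ZMod 2) W + r = 4 * k) {A : Finset F}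
    (hA : ∀ t ∈ LinearMap.ker (relTrace F k), t ≠ 0 → ∀ x, t * x ∈ A ↔ x ∈ A) :
    A.card * (Fintype.card F : ℝ) * (2 ^ k / 2 ^ r - 1) ≤
      ((2 : ℝ) ^ k - 1) * ((A ×ˢ (Finset.univ : Finset F)).filter (· ∈ W)).card := by
  have h := sum_card_multipliers hF W hA
  have hle : ∑ _z ∈ A ×ˢ (Finset.univ : Finset F), (2 : ℝ) ^ k / 2 ^ r ≤
      ∑ z ∈ A ×ˢ (Finset.univ : Finset F), (2 : ℝ) ^ finrank (ZMod 2) (multipliers k W z) := by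
    refine Finset.sum_le_sum fun z _ => ?_
    rw [div_le_iff₀ (by positivity), ← pow_add]
    exact pow_le_pow_right₀ one_le_two
      (le_finrank_multipliers_add hF (by rw [hW, finrank_prod_eq hF]) z)
  rw [Finset.sum_const, Finset.card_product, Finset.card_univ, nsmul_eq_mul, h] at hle
  push_cast at hle
  linarith

lemma range_lineForm (hF : Fintype.card F = 2 ^ (2 * k)) {w : F} (hw : w ≠ 0) :
    LinearMap.range (lineForm k w) = LinearMap.ker (relTrace F k) := by
  rw [← range_relTrace hF]
  ext y
  constructor
  · rintro ⟨z, rfl⟩; exact ⟨_, rfl⟩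
  · rintro ⟨x, rfl⟩
    exact ⟨(w * x, 0), by rw [lineForm_apply, inv_mul_cancel_left₀ hw]⟩

lemma finrank_ker_lineForm (hF : Fintype.card F = 2 ^ (2 * k)) {w : F} (hw : w ≠ 0) :
    finrank (ZMod 2) (LinearMap.ker (lineForm k w)) = 3 * k := by
  have h := LinearMap.finrank_range_add_finrank_ker (lineForm k w)
  rw [range_lineForm hF hw, finrank_ker_relTrace hF, finrank_prod_eq hF] at h
  omega

open Classical in
/-- The bound of `le_card_filter_mem` is attained by the preimages under `lineForm` of subspaces
of the subfield, as soon as `A` misses the line of `w`. -/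
lemma exists_card_filter_mem_eq (hF : Fintype.card F = 2 ^ (2 * k)) {r : ℕ} (hr : r ≤ k)
    {A : Finset F} (hA : ∀ t ∈ LinearMap.ker (relTrace F k), t ≠ 0 → ∀ x, t * x ∈ A ↔ x ∈ A)
    (h0 : (0 : F) ∉ A) {w : F} (hw : w ≠ 0) (hwA : w ∉ A) :
    ∃ W : Submodule (ZMod 2) (F × F), finrank (ZMod 2) W + r = 4 * k ∧
      ((2 : ℝ) ^ k - 1) * ((A ×ˢ (Finset.univ : Finset F)).filter (· ∈ W)).card =
        A.card * (Fintype.card F : ℝ) * (2 ^ k / 2 ^ r - 1) := by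
  obtain ⟨P, hPK, hP⟩ := exists_submodule_le_finrank_eq (LinearMap.ker (relTrace F k))
    (s := k - r) (by rw [finrank_ker_relTrace hF]; omega)
  refine ⟨P.comap (lineForm k w), ?_, ?_⟩
  · rw [finrank_comap_of_le_range _ (by rwa [range_lineForm hF hw]), finrank_ker_lineForm hF hw, hP]
    omega
  have h := sum_card_multipliers hF (P.comap (lineForm k w)) hA
  have hmul : ∀ z ∈ A ×ˢ (Finset.univ : Finset F),
      (2 : ℝ) ^ finrank (ZMod 2) (multipliers k (P.comap (lineForm k w)) z) = 2 ^ k / 2 ^ r := by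
    intro z hz
    have hc := lineForm_ne_zero hw hA h0 hwA (Finset.mem_product.mp hz).1
    set c := lineForm k w z
    have hcK : c ∈ LinearMap.ker (relTrace F k) := by
      rw [← range_lineForm hF hw]; exact ⟨z, rfl⟩
    have hform {t : F} (ht : t ∈ LinearMap.ker (relTrace F k)) :
        lineForm k w (t • z) = t * c := by
      rw [lineForm_apply, Prod.smul_fst, smul_eq_mul, mul_left_comm, relTrace_mul ht]
      rfl
    have heq : multipliers k (P.comap (lineForm k w)) z =
        P.comap (LinearMap.mulRight (ZMod 2) c) := by
      ext t
      rw [mem_multipliers, Submodule.mem_comap, Submodule.mem_comap, LinearMap.mulRight_apply]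
      constructor
      · rintro ⟨ht, h⟩
        rwa [hform ht] at h
      · intro h
        have ht : t ∈ LinearMap.ker (relTrace F k) := by
          have := mul_mem_ker_relTrace (hPK h) (inv_mem_ker_relTrace hcK)
          rwa [mul_inv_cancel_right₀ hc] at this
        exact ⟨ht, by rwa [hform ht]⟩
    have hrange : LinearMap.range (LinearMap.mulRight (ZMod 2) c) = ⊤ :=
      LinearMap.range_eq_top.mpr fun y => ⟨y * c⁻¹, by simp [hc]⟩
    have hker : LinearMap.ker (LinearMap.mulRight (ZMod 2) c) = ⊥ :=
      LinearMap.ker_eq_bot.mpr (mul_left_injective₀ hc)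
    rw [heq, finrank_comap_of_le_range _ (by rw [hrange]; exact le_top), hker, finrank_bot, hP,
      add_zero, eq_div_iff (by positivity), ← pow_add, Nat.sub_add_cancel hr]
  rw [Finset.sum_congr rfl hmul, Finset.sum_const, Finset.card_product, Finset.card_univ,
    nsmul_eq_mul] at h
  push_cast at h
  linarith

lemma exists_forall_notMem (hF : Fintype.card F = 2 ^ (2 * k)) {r : ℕ} (hr : k ≤ r)
    (hr' : r ≤ 4 * k) {A : Finset F}
    (hA : ∀ t ∈ LinearMap.ker (relTrace F k), t ≠ 0 → ∀ x, t * x ∈ A ↔ x ∈ A)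
    (h0 : (0 : F) ∉ A) {w : F} (hw : w ≠ 0) (hwA : w ∉ A) :
    ∃ W : Submodule (ZMod 2) (F × F), finrank (ZMod 2) W + r = 4 * k ∧
      ∀ z : F × F, z.1 ∈ A → z ∉ W := by
  obtain ⟨W, hle, hW⟩ := exists_submodule_le_finrank_eq (LinearMap.ker (lineForm k w))
    (s := 4 * k - r) (by rw [finrank_ker_lineForm hF hw]; omega)
  exact ⟨W, by omega, fun z hz h => lineForm_ne_zero hw hA h0 hwA hz (hle h)⟩

open Classical in
/-- The number of points outside `W` whose first coordinate is not in `A`, by inclusion and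
exclusion. -/
lemma ncard_notMem (hF : Fintype.card F = 2 ^ (2 * k)) {W : Submodule (ZMod 2) (F × F)}
    {r : ℕ} (hW : finrank (ZMod 2) W + r = 4 * k) (A : Finset F) :
    ({z : F × F | z.1 ∉ A ∧ z ∉ W}.ncard : ℝ) =
      (Fintype.card F : ℝ) ^ 2 - (Fintype.card F : ℝ) ^ 2 / 2 ^ r - A.card * Fintype.card F +
        ((A ×ˢ (Finset.univ : Finset F)).filter (· ∈ W)).card := by
  set B := A ×ˢ (Finset.univ : Finset F)
  have hWcard : ((Finset.univ.filter (· ∈ W)).card : ℝ) = (Fintype.card F : ℝ) ^ 2 / 2 ^ r := by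
    have h := Module.natCard_eq_pow_finrank (K := ZMod 2) (V := W)
    rw [Nat.card_zmod, Nat.card_eq_fintype_card, Fintype.card_subtype] at h
    rw [h, hF, eq_div_iff (by positivity)]
    push_cast
    rw [← pow_add, hW, ← pow_mul]
    congr 1
    ring
  have hset : {z : F × F | z.1 ∉ A ∧ z ∉ W} =
      ↑((Finset.univ : Finset (F × F)) \ (B ∪ Finset.univ.filter (· ∈ W))) := by
    ext z
    simp [B]
  have hinter : B ∩ Finset.univ.filter (· ∈ W) = B.filter (· ∈ W) := by
    ext z
    simp
  have hB : B.card = A.card * Fintype.card F := by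
    rw [Finset.card_product, Finset.card_univ]
  have hui := Finset.card_union_add_card_inter B (Finset.univ.filter (· ∈ W))
  have hsd := Finset.card_sdiff_add_card_eq_card
    (Finset.subset_univ (B ∪ Finset.univ.filter (· ∈ W)))
  rw [hinter, hB] at hui
  rw [Finset.card_univ, Fintype.card_prod] at hsd
  rw [hset, Set.ncard_coe_finset, ← hWcard]
  have hui' := congrArg (Nat.cast : ℕ → ℝ) hui
  have hsd' := congrArg (Nat.cast : ℕ → ℝ) hsd
  push_cast at hui' hsd'
  linarith

end ConePoints

/-! ### Weights of codes whose defining set is a cone -/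

section PuncturedCone

variable {F : Type*} [Field F] [Algebra (ZMod 2) F] {k : ℕ} {A : Finset F}
  {D : Set (F × F)}

lemma setOf_mem_notMem_eq (hD : ∀ z, z ∈ D ↔ z ≠ 0 ∧ z.1 ∉ A) (W : Submodule (ZMod 2) (F × F)) :
    {z | z ∈ D ∧ z ∉ W} = {z : F × F | z.1 ∉ A ∧ z ∉ W} := by
  ext z
  simp only [Set.mem_ofPred_eq, hD]
  exact ⟨fun h => ⟨h.1.2, h.2⟩, fun h => ⟨⟨fun h0 => h.2 (h0 ▸ W.zero_mem), h.1⟩, h.2⟩⟩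

variable [Fintype F]

/-- If `A` is not too large, its complement times `F` spans `F × F`. -/
lemma traceMap_injective_of_card_lt (hF : Fintype.card F = 2 ^ (2 * k))
    (hA : ∀ t ∈ LinearMap.ker (relTrace F k), t ≠ 0 → ∀ x, t * x ∈ A ↔ x ∈ A)
    (hD : ∀ z, z ∈ D ↔ z ≠ 0 ∧ z.1 ∉ A) (hcard : (A.card : ℝ) < 2 ^ k * (2 ^ k - 1)) :
    Function.Injective (traceMap D) := by
  classical
  refine traceMap_injective fun W hW hDW => ?_
  rw [finrank_prod_eq hF] at hW
  have hn := ncard_notMem hF hW A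
  have hX := le_card_filter_mem hF hW hA
  have hempty : {z | z ∈ D ∧ z ∉ W} = ∅ := by
    ext z
    simpa using fun hz => hDW hz
  rw [← setOf_mem_notMem_eq hD, hempty, Set.ncard_empty, Nat.cast_zero] at hn
  have hq : (Fintype.card F : ℝ) = 2 ^ k * 2 ^ k := by
    rw [hF, two_mul, pow_add]; push_cast; ring
  rw [hq] at hn hX
  set Q : ℝ := 2 ^ k
  have hQ : 0 < Q := by positivity
  set X : ℝ := (((A ×ˢ (Finset.univ : Finset F)).filter (· ∈ W)).card : ℝ)
  have hXeq : X = A.card * (Q * Q) - (Q * Q) ^ 2 / 2 := by linarith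
  rw [hXeq] at hX
  have hpos : 0 < Q * Q * Q * (Q * (Q - 1) - A.card) :=
    mul_pos (by positivity) (sub_pos.mpr hcard)
  nlinarith

lemma generalizedHammingWeight_of_le (hF : Fintype.card F = 2 ^ (2 * k))
    (hA : ∀ t ∈ LinearMap.ker (relTrace F k), t ≠ 0 → ∀ x, t * x ∈ A ↔ x ∈ A)
    (h0 : (0 : F) ∉ A) {w : F} (hw : w ≠ 0) (hwA : w ∉ A)
    (hD : ∀ z, z ∈ D ↔ z ≠ 0 ∧ z.1 ∉ A) (hinj : Function.Injective (traceMap D)) {r : ℕ}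
    (hr : r ≤ k) :
    (generalizedHammingWeight (codeOfDefiningSet D) r : ℝ) =
      (Fintype.card F : ℝ) ^ 2 - (Fintype.card F : ℝ) ^ 2 / 2 ^ r - A.card * Fintype.card F +
        A.card * (Fintype.card F : ℝ) * (2 ^ k / 2 ^ r - 1) / (2 ^ k - 1) := by
  classical
  have hk : k ≠ 0 := by
    rintro rfl
    exact Fintype.one_lt_card.ne' hF
  have hQ : (0 : ℝ) < 2 ^ k - 1 := sub_pos.mpr (one_lt_pow₀ one_lt_two hk)
  obtain ⟨W, hW, hX⟩ := exists_card_filter_mem_eq hF hr hA h0 hw hwA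
  have hWn := ncard_notMem hF hW A
  rw [eq_div_of_mul_eq hQ.ne' ((mul_comm _ _).trans hX)] at hWn
  rw [generalizedHammingWeight_eq hinj, finrank_prod_eq hF, ← hWn, Nat.cast_inj]
  simp only [setOf_mem_notMem_eq hD]
  refine IsLeast.csInf_eq ⟨⟨W, hW, rfl⟩, ?_⟩
  rintro _ ⟨W', hW', rfl⟩
  have hX' := le_card_filter_mem hF hW' hA
  have hWn' := ncard_notMem hF hW' A
  have := (div_le_iff₀' hQ).mpr hX'
  have hle : ({z : F × F | z.1 ∉ A ∧ z ∉ W}.ncard : ℝ) ≤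
      {z : F × F | z.1 ∉ A ∧ z ∉ W'}.ncard := by linarith
  exact_mod_cast hle

lemma generalizedHammingWeight_of_ge (hF : Fintype.card F = 2 ^ (2 * k))
    (hA : ∀ t ∈ LinearMap.ker (relTrace F k), t ≠ 0 → ∀ x, t * x ∈ A ↔ x ∈ A)
    (h0 : (0 : F) ∉ A) {w : F} (hw : w ≠ 0) (hwA : w ∉ A)
    (hD : ∀ z, z ∈ D ↔ z ≠ 0 ∧ z.1 ∉ A) (hinj : Function.Injective (traceMap D)) {r : ℕ}
    (hr : k ≤ r) (hr' : r ≤ 4 * k) :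
    (generalizedHammingWeight (codeOfDefiningSet D) r : ℝ) =
      (Fintype.card F : ℝ) ^ 2 - (Fintype.card F : ℝ) ^ 2 / 2 ^ r -
        A.card * Fintype.card F := by
  classical
  obtain ⟨W, hW, hX⟩ := exists_forall_notMem hF hr hr' hA h0 hw hwA
  have hWn := ncard_notMem hF hW A
  rw [Finset.filter_eq_empty_iff.mpr fun z hz => hX z (Finset.mem_product.mp hz).1,
    Finset.card_empty, Nat.cast_zero, add_zero] at hWn
  rw [generalizedHammingWeight_eq hinj, finrank_prod_eq hF, ← hWn, Nat.cast_inj]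
  simp only [setOf_mem_notMem_eq hD]
  refine IsLeast.csInf_eq ⟨⟨W, hW, rfl⟩, ?_⟩
  rintro _ ⟨W', hW', rfl⟩
  have hWn' := ncard_notMem hF hW' A
  have hle : ({z : F × F | z.1 ∉ A ∧ z ∉ W}.ncard : ℝ) ≤
      {z : F × F | z.1 ∉ A ∧ z ∉ W'}.ncard := by
    rw [hWn, hWn']
    exact le_add_of_nonneg_right (Nat.cast_nonneg _)
  exact_mod_cast hle

end PuncturedCone

/-! ### Arithmetic of the prime power modulus -/

section Arithmetic

variable {l m : ℕ}

lemma odd_of_orderOf_two (hl : l.Prime) (hm : 1 ≤ m)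
    (h2 : orderOf (2 : ZMod (l ^ m)) = Nat.totient (l ^ m)) : Odd l := by
  have hpos : 0 < orderOf (2 : ZMod (l ^ m)) := by
    rw [h2]; exact Nat.totient_pos.mpr (pow_pos hl.pos m)
  have hu : IsUnit ((2 : ℕ) : ZMod (l ^ m)) := (orderOf_pos_iff.mp hpos).isUnit
  rw [ZMod.isUnit_iff_coprime, Nat.coprime_pow_right_iff (by omega)] at hu
  exact Nat.coprime_two_left.mp hu

lemma even_totient_prime_pow (hl : l.Prime) (hm : 1 ≤ m) (hodd : Odd l) :
    Even (Nat.totient (l ^ m)) := by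
  refine Nat.totient_even ?_
  have h3 : 3 ≤ l := by
    have := hl.two_le
    have : l ≠ 2 := by rintro rfl; exact absurd hodd (by decide)
    omega
  exact lt_of_lt_of_le h3 (Nat.le_self_pow (by omega) l)

/-- If `2` is a primitive root modulo an odd prime power, then half its order gives `-1`. -/
lemma dvd_two_pow_half_totient_add_one (hl : l.Prime) (hm : 1 ≤ m)
    (h2 : orderOf (2 : ZMod (l ^ m)) = Nat.totient (l ^ m)) {k : ℕ}
    (hk : Nat.totient (l ^ m) = 2 * k) : l ^ m ∣ 2 ^ k + 1 := by
  have hpos : 0 < Nat.totient (l ^ m) := Nat.totient_pos.mpr (pow_pos hl.pos m)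
  have h1 : 1 ≤ 2 ^ k := Nat.one_le_two_pow
  have hcast : ((2 ^ k - 1 : ℕ) : ZMod (l ^ m)) = 2 ^ k - 1 := by
    rw [Nat.cast_sub h1]; push_cast; ring
  have hdvd : l ^ m ∣ (2 ^ k - 1) * (2 ^ k + 1) := by
    rw [← ZMod.natCast_eq_zero_iff, Nat.cast_mul, hcast]
    push_cast
    have h := pow_orderOf_eq_one (2 : ZMod (l ^ m))
    rw [h2, hk, mul_comm, pow_mul] at h
    linear_combination h
  have hcop : Nat.Coprime (2 ^ k - 1) (2 ^ k + 1) := by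
    have hk0 : k ≠ 0 := by omega
    have he : Even (2 ^ k) := (Nat.even_pow' hk0).mpr even_two
    have ho : Odd (2 ^ k - 1) := Nat.Even.sub_odd h1 he odd_one
    have : 2 ^ k + 1 = 2 + (2 ^ k - 1) := by omega
    rw [this, Nat.coprime_add_self_right]
    exact Nat.coprime_two_right.mpr ho
  rcases (hcop.isPrimePow_dvd_mul (hl.isPrimePow.pow (by omega))).mp hdvd with h | h
  · rw [← ZMod.natCast_eq_zero_iff, hcast, sub_eq_zero] at h
    have := Nat.le_of_dvd (by omega) (orderOf_dvd_of_pow_eq_one h)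
    omega
  · exact h

lemma two_mul_lt_two_pow {k : ℕ} (hk : 3 ≤ k) : 2 * k < 2 ^ k := by
  induction k, hk using Nat.le_induction with
  | base => norm_num
  | succ n hn ih => rw [pow_succ]; omega

end Arithmetic

/-! ### Counting vanishing traces -/

section CharacterSum

lemma sum_eq_add_sum_range_primitiveRoot {R : Type*} [AddCommMonoid R] {F : Type*} [Field F]
    [Fintype F] {γ : F}
    (hγ : IsPrimitiveRoot γ (Fintype.card F - 1)) (f : F → R) :
    ∑ x, f x = f 0 + ∑ i ∈ Finset.range (Fintype.card F - 1), f (γ ^ i) := by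
  classical
  have hq : 0 < Fintype.card F - 1 := Nat.sub_pos_of_lt Fintype.one_lt_card
  have hinj : Set.InjOn (γ ^ ·) (Finset.range (Fintype.card F - 1) : Set ℕ) := fun i hi j hj h =>
    hγ.pow_inj (Finset.mem_range.mp hi) (Finset.mem_range.mp hj) h
  have himage : (Finset.range (Fintype.card F - 1)).image (γ ^ ·) = Finset.univ.erase 0 := by
    refine Finset.eq_of_subset_of_card_le ?_ ?_
    · intro x hx
      obtain ⟨i, -, rfl⟩ := Finset.mem_image.mp hx
      exact Finset.mem_erase.mpr ⟨pow_ne_zero _ (hγ.ne_zero hq.ne'), Finset.mem_univ _⟩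
    · rw [Finset.card_image_of_injOn hinj, Finset.card_range,
        Finset.card_erase_of_mem (Finset.mem_univ _), Finset.card_univ]
  rw [← Finset.add_sum_erase _ _ (Finset.mem_univ (0 : F)), ← himage, Finset.sum_image hinj]

variable {F : Type*} [Field F] [Algebra (ZMod 2) F]

lemma canonicalChar_eq_ite (x : F) :
    canonicalChar x = if Algebra.trace (ZMod 2) F x = 0 then 1 else -1 := by
  have h : ∀ c : ZMod 2, (-1 : ℤ) ^ c.val = if c = 0 then 1 else -1 := by decide
  exact h _

/-- Summing over a coset of the roots of unity of odd order `l` gives `0`, so not every term can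
have trace `1`. -/
lemma exists_trace_eq_zero {l : ℕ} (hl : 1 < l) (hodd : Odd l) {ω : F} (hω : IsPrimitiveRoot ω l)
    (b : F) : ∃ j < l, Algebra.trace (ZMod 2) F (b * ω ^ j) = 0 := by
  by_contra! h
  have h01 : ∀ c : ZMod 2, c ≠ 0 → c = 1 := by decide
  have hsum : ∑ j ∈ Finset.range l, Algebra.trace (ZMod 2) F (b * ω ^ j) = 0 := by
    rw [← map_sum, ← Finset.mul_sum, hω.geom_sum_eq_zero hl, mul_zero, map_zero]
  rw [Finset.sum_congr rfl fun j hj => h01 _ (h j (Finset.mem_range.mp hj))] at hsum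
  rw [Finset.sum_const, Finset.card_range, nsmul_one, ZMod.natCast_eq_zero_iff] at hsum
  exact (Nat.not_even_iff_odd.mpr hodd) (even_iff_two_dvd.mpr hsum)

/-- The number of exponents `i < N` with `Tr (a α ^ i) = 0`. -/
def traceZeros (N : ℕ) (α a : F) : ℕ :=
  ((Finset.range N).filter fun i => Algebra.trace (ZMod 2) F (a * α ^ i) = 0).card

lemma sum_canonicalChar_eq {ι : Type*} (s : Finset ι) (f : ι → F) :
    ∑ i ∈ s, canonicalChar (f i) =
      2 * (s.filter fun i => Algebra.trace (ZMod 2) F (f i) = 0).card - s.card := by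
  have h := Finset.card_filter_add_card_filter_not (s := s)
    (fun i => Algebra.trace (ZMod 2) F (f i) = 0)
  simp_rw [canonicalChar_eq_ite]
  rw [Finset.sum_ite, Finset.sum_const, Finset.sum_const]
  simp only [nsmul_eq_mul]
  push_cast [← h]
  ring

lemma exists_trace_eq_zero_add {l m : ℕ} (hl : l.Prime) (hm : 1 ≤ m) (hodd : Odd l) {α : F}
    (hα : IsPrimitiveRoot α (l ^ m)) (a : F) (i : ℕ) :
    ∃ j < l, Algebra.trace (ZMod 2) F (a * α ^ (i + l ^ (m - 1) * j)) = 0 := by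
  have hω : IsPrimitiveRoot (α ^ l ^ (m - 1)) l :=
    hα.pow (pow_pos hl.pos m) (by rw [← pow_succ, Nat.sub_add_cancel hm])
  obtain ⟨j, hj, h⟩ := exists_trace_eq_zero hl.one_lt hodd hω (a * α ^ i)
  exact ⟨j, hj, by rwa [pow_add, pow_mul, ← mul_assoc]⟩

lemma traceZeros_pos {l m : ℕ} (hl : l.Prime) (hm : 1 ≤ m) (hodd : Odd l) {α : F}
    (hα : IsPrimitiveRoot α (l ^ m)) (a : F) : 0 < traceZeros (l ^ m) α a := by
  obtain ⟨j, hj, h⟩ := exists_trace_eq_zero_add hl hm hodd hα a 0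
  refine Finset.card_pos.mpr ⟨_, Finset.mem_filter.mpr ⟨Finset.mem_range.mpr ?_, h⟩⟩
  calc 0 + l ^ (m - 1) * j < l ^ (m - 1) * l := by
        rw [zero_add]; exact Nat.mul_lt_mul_of_pos_left hj (pow_pos hl.pos _)
    _ = l ^ m := by rw [← pow_succ, Nat.sub_add_cancel hm]

lemma one_lt_traceZeros {l m : ℕ} (hl : l.Prime) (hm : 2 ≤ m) (hodd : Odd l) {α : F}
    (hα : IsPrimitiveRoot α (l ^ m)) (a : F) : 1 < traceZeros (l ^ m) α a := by
  have hpow : l ^ m = l ^ (m - 1) * l := by rw [← pow_succ, Nat.sub_add_cancel (by omega)]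
  have h1 : 1 < l ^ (m - 1) := Nat.one_lt_pow (by omega) hl.one_lt
  obtain ⟨j, hj, h⟩ := exists_trace_eq_zero_add hl (by omega) hodd hα a 0
  obtain ⟨j', hj', h'⟩ := exists_trace_eq_zero_add hl (by omega) hodd hα a 1
  have hlt (i : ℕ) (hi : i < l) : 1 + l ^ (m - 1) * i < l ^ m := by
    calc 1 + l ^ (m - 1) * i < l ^ (m - 1) * (i + 1) := by rw [mul_add_one]; omega
      _ ≤ l ^ m := by rw [hpow]; exact Nat.mul_le_mul_left _ hi
  refine Finset.one_lt_card.mpr ⟨_, Finset.mem_filter.mpr ⟨Finset.mem_range.mpr ?_, h⟩,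
    _, Finset.mem_filter.mpr ⟨Finset.mem_range.mpr (hlt j' hj'), h'⟩, fun heq => ?_⟩
  · have := hlt j hj
    omega
  · have hmod := congrArg (· % l ^ (m - 1)) heq
    simp [Nat.mod_eq_of_lt h1] at hmod

/-- The exceptional cases `l ^ m = 3`, and `l ^ m = 5` with character sum `-3`, are those in which
`l ^ m = 2 ^ k + 1` and only one trace vanishes. -/
lemma lt_traceZeros_mul {l m : ℕ} (hl : l.Prime) (hm : 1 ≤ m) (hodd : Odd l) {k : ℕ}
    (hk : Nat.totient (l ^ m) = 2 * k) (hdvd : l ^ m ∣ 2 ^ k + 1) {α : F}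
    (hα : IsPrimitiveRoot α (l ^ m)) (a : F) (h3 : l ^ m ≠ 3)
    (h5 : l ^ m = 5 → traceZeros (l ^ m) α a ≠ 1) :
    l ^ m < traceZeros (l ^ m) α a * (2 ^ k + 1) := by
  have hpos := traceZeros_pos hl hm hodd hα a
  rcases (Nat.le_of_dvd (Nat.succ_pos _) hdvd).lt_or_eq with hlt | heq
  · exact hlt.trans_le (Nat.le_mul_of_pos_left _ hpos)
  suffices 1 < traceZeros (l ^ m) α a by
    refine heq.trans_lt ?_
    exact lt_mul_of_one_lt_left (Nat.succ_pos _) this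
  rcases hm.eq_or_lt with rfl | hm2
  · rw [pow_one] at heq
    rw [Nat.totient_prime_pow hl hm, Nat.sub_self, pow_zero, one_mul] at hk
    -- `2 ^ k = 2 k` forces `k ≤ 2`
    have hk2 : k ≤ 2 := by
      by_contra! hk3
      have := two_mul_lt_two_pow hk3
      omega
    have hl1 := hl.one_lt
    interval_cases k
    · omega
    · exact absurd (by rw [heq]; norm_num) h3
    · have := h5 (by rw [heq]; norm_num)
      omega
  · exact one_lt_traceZeros hl hm2 hodd hα a

lemma sum_range_mul_of_periodic {R : Type*} [CommSemiring R] {N : ℕ} {g : ℕ → R}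
    (hg : Function.Periodic g N) (M : ℕ) :
    ∑ i ∈ Finset.range (M * N), g i = M * ∑ i ∈ Finset.range N, g i := by
  induction M with
  | zero => simp
  | succ M ih =>
    have hshift (i : ℕ) : g (M * N + i) = g i := by
      rw [add_comm]
      exact hg.nat_mul M i
    rw [Nat.succ_mul, Finset.sum_range_add, ih]
    simp_rw [hshift]
    push_cast
    ring

variable [Fintype F]

open Classical in
/-- The number of `x` with `Tr (a x ^ M) = 1` is determined by the character sum. -/
lemma two_mul_card_trace_ne_zero {N M : ℕ} {γ : F} (hγ : IsPrimitiveRoot γ (Fintype.card F - 1))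
    (hM : Fintype.card F - 1 = M * N) (a : F) :
    2 * ((Finset.univ.filter fun x : F => Algebra.trace (ZMod 2) F (a * x ^ M) ≠ 0).card : ℤ) =
      Fintype.card F - 1 -
        M * ∑ i ∈ Finset.range N, canonicalChar (a * (γ ^ M) ^ i) := by
  have hq : 0 < Fintype.card F - 1 := Nat.sub_pos_of_lt Fintype.one_lt_card
  have hM0 : M ≠ 0 := by rintro rfl; omega
  have hper : Function.Periodic (fun i => canonicalChar (a * (γ ^ M) ^ i)) N := fun i => by
    have h1 : (γ ^ M) ^ N = 1 := by rw [← pow_mul, ← hM, hγ.pow_eq_one]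
    simp only [pow_add, h1, mul_one]
  have h := sum_eq_add_sum_range_primitiveRoot hγ (fun x => canonicalChar (a * x ^ M))
  simp_rw [← pow_mul, mul_comm _ M, pow_mul, hM] at h
  rw [sum_range_mul_of_periodic hper, sum_canonicalChar_eq, zero_pow hM0, mul_zero,
    canonicalChar_eq_ite, if_pos (map_zero _), Finset.card_univ] at h
  have hc := Finset.card_filter_add_card_filter_not (s := (Finset.univ : Finset F))
    (fun x => Algebra.trace (ZMod 2) F (a * x ^ M) = 0)
  rw [Finset.card_univ] at hc
  have hc' := congrArg (Nat.cast : ℕ → ℤ) hc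
  push_cast at hc'
  linarith

end CharacterSum

end LinearCode

end

/-! ### The weight hierarchy -/

theorem theorem3 {l m : ℕ} (hl : l.Prime) (hm : 1 ≤ m)
    (h2 : orderOf (2 : ZMod (l ^ m)) = Nat.totient (l ^ m))
    {F : Type*} [Field F] [Fintype F] [Algebra (ZMod 2) F]
    (hF : Fintype.card F = 2 ^ Nat.totient (l ^ m))
    (γ : F) (hγ : IsPrimitiveRoot γ (Fintype.card F - 1))
    (a : F) (ha : a ≠ 0)
    (h3 : l ^ m ≠ 3) (h5 : ¬ (l ^ m = 5 ∧ LinearCode.charSum (l ^ m) γ a = -3)) :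
    let q : ℝ := (Fintype.card F : ℝ)
    let S : ℝ := (LinearCode.charSum (l ^ m) γ a : ℝ)
    let C := LinearCode.codeOfDefiningSet (LinearCode.definingSet (l ^ m) a 0)
    Module.finrank (ZMod 2) C = 2 * Nat.totient (l ^ m) ∧
    ∀ r : ℕ,
      (1 ≤ r → (r : ℝ) ≤ (1 / 2 : ℝ) * (Nat.totient (l ^ m) : ℝ) →
        (LinearCode.generalizedHammingWeight C r : ℝ) =
          (1 / 2 : ℝ) * q * (1 - 1 / (2 : ℝ) ^ r) *
            (q - Real.sqrt q + (q + Real.sqrt q) * S / (l : ℝ) ^ m)) ∧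
      ((1 / 2 : ℝ) * (Nat.totient (l ^ m) : ℝ) < (r : ℝ) → r ≤ 2 * Nat.totient (l ^ m) →
        (LinearCode.generalizedHammingWeight C r : ℝ) =
          (1 / 2 : ℝ) * q * (q + 1 + (q - 1) * S / (l : ℝ) ^ m) -
            1 / (2 : ℝ) ^ r * q ^ 2) := by
  classical
  intro q S C
  have hodd := LinearCode.odd_of_orderOf_two hl hm h2
  obtain ⟨k, hk⟩ := (LinearCode.even_totient_prime_pow hl hm hodd).two_dvd
  have hdvd := LinearCode.dvd_two_pow_half_totient_add_one hl hm h2 hk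
  have hF' : Fintype.card F = 2 ^ (2 * k) := by rw [hF, hk]
  have hk0 : k ≠ 0 := by
    rintro rfl
    exact Fintype.one_lt_card.ne' hF'
  have hN : 0 < l ^ m := pow_pos hl.pos m
  have hq1 : 0 < Fintype.card F - 1 := Nat.sub_pos_of_lt Fintype.one_lt_card
  obtain ⟨c, hc⟩ := hdvd
  -- the exponent `M = (q - 1) / l ^ m` is a multiple of `√q - 1`
  have hfac : Fintype.card F - 1 = (2 ^ k - 1) * c * l ^ m := by
    rw [mul_assoc, mul_comm c, ← hc, hF', mul_comm 2 k, pow_mul, mul_comm,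
      ← Nat.sq_sub_sq, one_pow]
  set M := (Fintype.card F - 1) / l ^ m with hMdef
  have hM : M = (2 ^ k - 1) * c := by rw [hMdef, hfac, Nat.mul_div_cancel _ hN]
  have hMN : Fintype.card F - 1 = M * l ^ m := by rw [hM, hfac]
  have hM0 : M ≠ 0 := by intro h; rw [h, zero_mul] at hMN; omega
  have hα : IsPrimitiveRoot (γ ^ M) (l ^ m) := hγ.pow hq1 hMN
  -- `n` vanishing traces and `l ^ m - n` others make up the character sum
  set n := LinearCode.traceZeros (l ^ m) (γ ^ M) a
  have hSn : LinearCode.charSum (l ^ m) γ a = 2 * n - (l ^ m : ℕ) := by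
    rw [LinearCode.charSum, LinearCode.sum_canonicalChar_eq, Finset.card_range]
    rfl
  have hn : l ^ m < n * (2 ^ k + 1) := by
    refine LinearCode.lt_traceZeros_mul hl hm hodd hk ⟨c, hc⟩ hα a h3 fun h hn1 => h5 ⟨h, ?_⟩
    rw [hSn, h, show n = 1 from hn1]
    norm_num
  set A : Finset F := Finset.univ.filter fun x => Algebra.trace (ZMod 2) F (a * x ^ M) ≠ 0
    with hAdef
  have hmemA (x : F) : x ∈ A ↔ Algebra.trace (ZMod 2) F (a * x ^ M) ≠ 0 := by simp [A]
  have hA : ∀ t ∈ LinearMap.ker (LinearCode.relTrace F k), t ≠ 0 → ∀ x, t * x ∈ A ↔ x ∈ A := by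
    intro t ht ht0 x
    have htM : t ^ M = 1 := by
      have : t ^ (2 ^ k - 1) = 1 := by
        refine mul_right_cancel₀ ht0 ?_
        rw [← pow_succ, Nat.sub_add_cancel Nat.one_le_two_pow, one_mul,
          LinearCode.mem_ker_relTrace.mp ht]
      rw [hM, pow_mul, this, one_pow]
    rw [hmemA, hmemA, mul_pow, htM, one_mul]
  have h0 : (0 : F) ∉ A := by simp [hmemA, hM0]
  -- `γ ^ j` with `Tr (a α ^ j) = 0` is a nonzero element outside `A`
  obtain ⟨i, -, hi⟩ := LinearCode.exists_trace_eq_zero_add hl hm hodd hα a 0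
  have hw : γ ^ (0 + l ^ (m - 1) * i) ≠ 0 := pow_ne_zero _ (hγ.ne_zero hq1.ne')
  have hwA : γ ^ (0 + l ^ (m - 1) * i) ∉ A := by
    rw [hmemA, not_not, ← pow_mul, mul_comm _ M, pow_mul, hi]
  have hD : ∀ z, z ∈ LinearCode.definingSet (l ^ m) a 0 ↔ z ≠ 0 ∧ z.1 ∉ A := by
    intro z
    rw [hmemA, not_not, LinearCode.definingSet, Set.mem_ofPred_eq, zero_mul, add_zero]
  have hcardZ := LinearCode.two_mul_card_trace_ne_zero hγ hMN a
  rw [← hAdef] at hcardZ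
  have hcardR : 2 * (A.card : ℝ) = q - 1 - M * S := by
    have := congrArg (Int.cast : ℤ → ℝ) hcardZ
    push_cast at this
    rw [this]
    simp only [S, LinearCode.charSum, q]
    push_cast
    rfl
  set Q : ℝ := 2 ^ k with hQdef
  have hQ1 : 1 < Q := one_lt_pow₀ one_lt_two hk0
  have hqQ : q = Q * Q := by
    simp only [q, hF', Q, two_mul, pow_add]; push_cast; ring
  have hsqrt : Real.sqrt q = Q := by rw [hqQ]; exact Real.sqrt_mul_self (by linarith)
  have hNR : (0 : ℝ) < (l : ℝ) ^ m := by exact_mod_cast hN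
  have hMNR : q - 1 = M * (l : ℝ) ^ m := by
    have := congrArg (Nat.cast : ℕ → ℝ) hMN
    rw [Nat.cast_sub Fintype.one_lt_card.le] at this
    push_cast at this
    exact this
  have hMR : (M : ℝ) = (Q * Q - 1) / (l : ℝ) ^ m := by
    rw [eq_div_iff hNR.ne', ← hMNR, hqQ]
  have hSR : S = 2 * n - (l : ℝ) ^ m := by
    have := congrArg (Int.cast : ℤ → ℝ) hSn
    push_cast at this
    exact this
  have hnR : (l : ℝ) ^ m < n * (Q + 1) := by
    have := (Nat.cast_lt (α := ℝ)).mpr hn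
    push_cast at this
    exact this
  have hcard : (A.card : ℝ) < Q * (Q - 1) := by
    rw [hMR, hqQ, hSR] at hcardR
    set N : ℝ := (l : ℝ) ^ m
    have hA' : (A.card : ℝ) * N = (Q - 1) * ((Q + 1) * N - n * (Q + 1)) := by
      field_simp at hcardR
      linarith
    refine lt_of_mul_lt_mul_right (a := N) ?_ hNR.le
    rw [hA']
    nlinarith [mul_pos (sub_pos.mpr hQ1) (sub_pos.mpr hnR)]
  have hinj := LinearCode.traceMap_injective_of_card_lt hF' hA hD hcard
  have hAeq : (A.card : ℝ) = (Q * Q - 1 - (Q * Q - 1) / (l : ℝ) ^ m * S) / 2 := by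
    rw [hMR, hqQ] at hcardR
    linarith
  refine ⟨?_, fun r => ⟨fun _ hr => ?_, fun hr hr' => ?_⟩⟩
  · rw [hk]
    refine (LinearMap.finrank_range_of_inj hinj).trans ?_
    rw [LinearCode.finrank_prod_eq hF']
    ring
  · have hrk : r ≤ k := by
      rw [hk] at hr
      push_cast at hr
      exact_mod_cast (by linarith : (r : ℝ) ≤ k)
    rw [LinearCode.generalizedHammingWeight_of_le hF' hA h0 hw hwA hD hinj hrk, hsqrt,
      show (Fintype.card F : ℝ) = Q * Q from hqQ, hqQ, hAeq, ← hQdef]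
    have : Q - 1 ≠ 0 := by linarith
    field_simp
    ring
  · have hrk : k ≤ r := by
      rw [hk] at hr
      push_cast at hr
      exact_mod_cast (by linarith : (k : ℝ) ≤ r)
    rw [LinearCode.generalizedHammingWeight_of_ge hF' hA h0 hw hwA hD hinj hrk (by omega),
      show (Fintype.card F : ℝ) = Q * Q from hqQ, hqQ, hAeq]
    field_simp
    ring
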